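/- **Conventions.** Let $k$ be a commutative ring, $R$ a commutative $k$-algebra that is flat over $k$, and $S$ a commutative $R$-algebra that is faithfully flat over $R$. An $R$-algebra is an $R$-module with an $R$-bilinear product (not assumed associative or unital). Let $n\ge 1$ and let $B$ be an $R$-algebra that is an $S/R$-form of $M_n(R)$, i.e. $B\otimes_R S\cong M_n(R)\otimes_R S$ as $S$-algebras. Let $\kappa(x,y)=\operatorname{tr}(xy)$ be the trace form of $M_n(k)$. A subscript $T$ on a bilinear form denotes base change to $T$. For a $k$-module $V$, an $(R,k)$-bilinear function $\beta\colon B\times B\to V$ is a $k$-bilinear one with $\beta(rb,b')=\beta(b,rb')$ for $r\in R$; these form an $R$-module under $(r\beta)(b,b')=\beta(rb,b')$. Such a $\beta$ is *invariant* if $\beta(ab,c)=\beta(a,bc)=\beta(b,ca)$ for all $a,b,c\in B$; $\mathrm{IBF}_{(R,k)}(B;V)$ is the $R$-module of invariant ones, and $\mathrm{IBF}_R(B)=\mathrm{IBF}_{(R,R)}(B;R)$. Let $\mathbf{IBF}_R(B)$ be the quotient of $B\otimes_R B$ by the $R$-span of all $ab\otimes c-a\otimes bc$ and $ab\otimes c-b\otimes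 ca$, and write $\overline{b\otimes b'}$ for the class of $b\otimes b'$. Let $\mathrm{AC}(B)$ be the quotient of $B$ by the submodule spanned by all associators $(ab)c-a(bc)$ and all commutators $ab-ba$. An $R$-bilinear form $\beta$ on $B$ is *nonsingular* if $B\to\operatorname{Hom}_R(B,R)$, $b\mapsto\beta(b,-)$, is bijective, and *$\mathbf{Aut}(B)$-invariant* if for every commutative $R$-algebra $T$ the form $\beta_T$ is invariant under all $T$-algebra automorphisms of $B\otimes_R T$. **Theorem.** There is a unique $R$-bilinear form $\kappa_B$ on $B$ such that $(\kappa_B)_{S'}(x,y)=\kappa_{S'}(\theta(x),\theta(y))$ for every faithfully flat commutative $R$-algebra $S'$, every isomorphism of $S'$-algebras $\theta\colon B\otimes_R S'\to M_n(k)\otimes_k S'$ and all $x,y\in B\otimes_R S'$. Moreover: (a) $\kappa_B$ is nonsingular, invariant and $\mathbf{Aut}(B)$-invariant, and $\{\kappa_B\}$ is a basis of the $R$-module $\mathrm{IBF}_R(B)$. (b) There are isomorphisms of $R$-modules $\mathbf{IBF}_R(B)\to\mathrm{AC}(B)$, $\overline{b\otimes b'}\mapsto\overline{bb'}$, and $\mathrm{AC}(B)\to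 R$, $\overline{bb'}\mapsto\kappa_B(b,b')$; in particular $\mathbf{IBF}_R(B)\to R$, $\overline{b\otimes b'}\mapsto\kappa_B(b,b')$, is an isomorphism of $R$-modules. Hence $(B,\kappa_B)$ satisfies the IBF-principle: for every $k$-module $V$ the map $\operatorname{Hom}_k(R,V)\to\mathrm{IBF}_{(R,k)}(B;V)$, $\varphi\mapsto\varphi\circ\kappa_B$, is an isomorphism of $R$-modules, where $R$ acts on $\operatorname{Hom}_k(R,V)$ by $(r\varphi)(x)=\varphi(rx)$. (c) If $B$ is realized as an $R$-subalgebra of $M_n(S)$ containing the identity matrix, then $\kappa_B$ is the restriction to $B$ of the trace form of $M_n(S)$. In particular this holds when $B$ is identified with $\{x\in M_n(S): u(\alpha_1(x))=\alpha_2(x)\}$ for some $u\in\operatorname{Aut}_{S\otimes_R S}(M_n(S\otimes_R S))$, where $\alpha_1,\alpha_2\colon M_n(S)\to M_n(S\otimes_R S)$ are induced by $s\mapsto s\otimes 1$ and $s\mapsto 1\otimes s$. -/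

import Mathlib

open scoped TensorProduct

universe u₁ u₂ u₃ v w w'

noncomputable section

namespace InvForm

/-! Throughout, an algebra over a commutative ring `R` is an `R`-module with an `R`-bilinear product;
neither associativity nor a unit is required. Base change is written `S ⊗[R] B`. -/

section Forms

variable (R : Type*) [CommRing R] (S : Type*) [CommRing S] [Algebra R S]

/-- `B` is an `S/R`-form of the `R`-algebra `A`: the `S`-algebras `S ⊗[R] B` and `S ⊗[R] A` are
isomorphic. -/
def IsSRForm (A B : Type*)
    [NonUnitalNonAssocRing A] [Module R A] [IsScalarTower R A A] [SMulCommClass R A A]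
    [NonUnitalNonAssocRing B] [Module R B] [IsScalarTower R B B] [SMulCommClass R B B] : Prop :=
  ∃ θ : (S ⊗[R] B) ≃ₗ[S] (S ⊗[R] A), ∀ x y, θ (x * y) = θ x * θ y

end Forms

section BilinearFunctions

variable (k R : Type*) [CommRing k] [CommRing R] [Algebra k R]

/-- The `(R,k)`-bilinear functions `M × M → V`: the `k`-bilinear `β` such that
`β (r m₁, m₂) = β (m₁, r m₂)` for all `r ∈ R`. -/
def bilinRk (M V : Type*) [AddCommGroup M] [Module R M] [Module k M]
    [AddCommGroup V] [Module k V] : AddSubgroup (M →ₗ[k] M →ₗ[k] V) where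
  carrier := {β | ∀ (r : R) (m₁ m₂ : M), β (r • m₁) m₂ = β m₁ (r • m₂)}
  add_mem' := by
    intro a b ha hb r m₁ m₂
    simp [ha r m₁ m₂, hb r m₁ m₂]
  zero_mem' := by
    intro r m₁ m₂
    simp
  neg_mem' := by
    intro a ha r m₁ m₂
    simp [ha r m₁ m₂]

section RModule

variable {k R} {M V : Type*} [AddCommGroup M] [Module R M] [Module k M] [IsScalarTower k R M]
  [AddCommGroup V] [Module k V]

instance : SMul R (bilinRk k R M V) where
  smul r β := ⟨β.1 ∘ₗ (Algebra.lsmul k k M r), by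
    intro s m₁ m₂
    simp only [LinearMap.comp_apply, Algebra.lsmul_coe]
    rw [smul_comm, β.2 s]⟩

theorem bilinRk_smul_apply (r : R) (β : bilinRk k R M V) (m₁ m₂ : M) :
    (r • β).1 m₁ m₂ = β.1 (r • m₁) m₂ := rfl

/-- The `R`-module structure `(r β)(m₁, m₂) = β (r m₁, m₂)`. -/
instance : Module R (bilinRk k R M V) where
  one_smul β := by ext; simp [bilinRk_smul_apply]
  mul_smul r s β := by ext; simp [bilinRk_smul_apply, mul_comm r s, mul_smul]
  smul_zero r := by ext; simp [bilinRk_smul_apply]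
  smul_add r β γ := by ext; simp [bilinRk_smul_apply]
  add_smul r s β := by ext; simp [bilinRk_smul_apply, add_smul]
  zero_smul β := by ext; simp [bilinRk_smul_apply]

end RModule

/-- A `k`-bilinear function `β` on an algebra `B` is invariant if
`β (a b, c) = β (a, b c) = β (b, c a)`. -/
def IsInvariant {k : Type*} [CommRing k] {B V : Type*} [NonUnitalNonAssocRing B] [Module k B]
    [AddCommGroup V] [Module k V] (β : B →ₗ[k] B →ₗ[k] V) : Prop :=
  ∀ a b c : B, β (a * b) c = β a (b * c) ∧ β a (b * c) = β b (c * a)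

/-- `IBF_{(R,k)}(B; V)`: the `R`-module of invariant `(R,k)`-bilinear functions `B × B → V`. -/
def IBF (B V : Type*) [NonUnitalNonAssocRing B] [Module R B]
    [IsScalarTower R B B] [SMulCommClass R B B] [Module k B] [IsScalarTower k R B]
    [AddCommGroup V] [Module k V] : Submodule R (bilinRk k R B V) where
  carrier := {β | IsInvariant β.1}
  add_mem' := by
    intro β γ hβ hγ a b c
    refine ⟨?_, ?_⟩
    · simp [(hβ a b c).1, (hγ a b c).1]
    · simp [(hβ a b c).2, (hγ a b c).2]
  zero_mem' := by
    intro a b c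
    simp
  smul_mem' := by
    intro r β hβ a b c
    simp only [bilinRk_smul_apply]
    refine ⟨?_, ?_⟩
    · rw [← smul_mul_assoc]
      exact (hβ (r • a) b c).1
    · rw [(hβ (r • a) b c).2, mul_smul_comm, ← β.2 r]

end BilinearFunctions

section Universal

variable (R : Type*) [CommRing R] (B : Type*) [NonUnitalNonAssocRing B] [Module R B]

/-- The submodule of `B ⊗[R] B` spanned by all `ab ⊗ c - a ⊗ bc` and `ab ⊗ c - b ⊗ ca`. -/
def ibf : Submodule R (B ⊗[R] B) :=
  Submodule.span R
    {t | ∃ a b c : B, t = (a * b) ⊗ₜ[R] c - a ⊗ₜ[R] (b * c) ∨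
      t = (a * b) ⊗ₜ[R] c - b ⊗ₜ[R] (c * a)}

/-- The target of the universal invariant `R`-bilinear function, `(B ⊗[R] B) / ibf`. -/
abbrev UIBF : Type _ := (B ⊗[R] B) ⧸ ibf R B

/-- The universal invariant `R`-bilinear function: the class of `a ⊗ b`. -/
def univ (a b : B) : UIBF R B := (ibf R B).mkQ (a ⊗ₜ[R] b)

/-- `ac(B) = (B,B,B) + [B,B]`: the sum of the span of the associators and of the span of the
commutators. (Both sets are stable under `R`, so `R`-spans and `ℤ`-spans agree.) -/
def ac : Submodule R B :=
  Submodule.span R {x | ∃ a b c : B, x = (a * b) * c - a * (b * c)} ⊔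
    Submodule.span R {x | ∃ a b : B, x = a * b - b * a}

/-- `AC(B) = B / ac(B)`. -/
abbrev AC : Type _ := B ⧸ ac R B

end Universal

section FormProperties

/-- An `R`-bilinear form is nonsingular if `M → Hom_R(M, R)`, `m ↦ β (m, -)`, is bijective. -/
def IsNonsingular {R M : Type*} [CommRing R] [AddCommGroup M] [Module R M]
    (β : LinearMap.BilinForm R M) : Prop :=
  Function.Bijective (fun m : M => (β m : M →ₗ[R] R))

/-- `β` is `Aut(B)`-invariant, for the automorphism group functor of `B`: for every commutative
`R`-algebra `T`, the form `β_T` is invariant under all `T`-algebra automorphisms of `T ⊗[R] B`. -/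
def IsAutInvariant {R B : Type*} [CommRing R] [NonUnitalNonAssocRing B] [Module R B]
    [IsScalarTower R B B] [SMulCommClass R B B] (β : LinearMap.BilinForm R B) : Prop :=
  ∀ (T : Type w) [CommRing T] [Algebra R T] (f : (T ⊗[R] B) ≃ₗ[T] (T ⊗[R] B)),
    (∀ x y, f (x * y) = f x * f y) →
      ∀ x y, β.baseChange T (f x) (f y) = β.baseChange T x y

/-- `(B, β)` satisfies the IBF-principle: `β` is invariant, the class of `a ⊗ b` is sent to `β (a, b)`
by an isomorphism of `R`-modules onto `R`, and for every `k`-module `V` the map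
`Hom_k(R, V) → IBF_{(R,k)}(B; V)`, `φ ↦ φ ∘ β`, is an isomorphism of `R`-modules, where
`(r φ)(x) = φ (r x)`. -/
def IBFPrinciple (k : Type*) {R B : Type*} [CommRing k] [CommRing R] [Algebra k R]
    [NonUnitalNonAssocRing B] [Module R B] [IsScalarTower R B B] [SMulCommClass R B B]
    [Module k B] [IsScalarTower k R B] (β : LinearMap.BilinForm R B) : Prop :=
  IsInvariant β ∧
  (∃ e : UIBF R B ≃ₗ[R] R, ∀ a b : B, e (univ R B a b) = β a b) ∧
  ∀ (V : Type w) [AddCommGroup V] [Module k V],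
    ∃ Φ : (R →ₗ[k] V) ≃+ IBF k R B V,
      (∀ (φ : R →ₗ[k] V) (a b : B), (Φ φ).1.1 a b = φ (β a b)) ∧
      (∀ (r : R) (φ : R →ₗ[k] V), Φ (φ ∘ₗ Algebra.lsmul k k R r) = r • Φ φ)

end FormProperties

section Descent

/-- Given a bilinear form `κ` on a `k`-algebra `A`, the `R`-bilinear form `κB` on `B` is the descended
form of `κ`: `(κB)_S = θ^*(κ_S)` for every faithfully flat `S/R` and every isomorphism of
`S`-algebras `θ : S ⊗[R] B ≃ S ⊗[k] A`. -/
def IsDescendedForm {k R A B : Type*} [CommRing k] [CommRing R] [Algebra k R]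
    [NonUnitalNonAssocRing A] [Module k A] [IsScalarTower k A A] [SMulCommClass k A A]
    [NonUnitalNonAssocRing B] [Module R B] [IsScalarTower R B B] [SMulCommClass R B B]
    (κ : LinearMap.BilinForm k A) (κB : LinearMap.BilinForm R B) : Prop :=
  ∀ (S : Type v) [CommRing S] [Algebra k S] [Algebra R S] [IsScalarTower k R S]
    [Module.FaithfullyFlat R S] (θ : (S ⊗[R] B) ≃ₗ[S] (S ⊗[k] A)),
    (∀ x y, θ (x * y) = θ x * θ y) →
      ∀ x y, κB.baseChange S x y = κ.baseChange S (θ x) (θ y)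

/-- The trace form `(x, y) ↦ tr (x y)` of the matrix algebra `M_n(k)`. -/
def traceForm (k : Type*) [CommRing k] (n : ℕ) :
    LinearMap.BilinForm k (Matrix (Fin n) (Fin n) k) :=
  (LinearMap.mul k (Matrix (Fin n) (Fin n) k)).compr₂ (Matrix.traceLinearMap (Fin n) k k)

/-- For `u ∈ Aut(M_n(S ⊗[R] S))`, the `R`-subalgebra of all `x ∈ M_n(S)` with `u (x ⊗ 1) = 1 ⊗ x`,
where the two embeddings of `S` in `S ⊗[R] S` are applied entrywise. For a cocycle `u` this is the
realization inside `M_n(S)` of the form of `M_n(R)` defined by `u`. -/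
def descentSubalgebra {R S : Type*} [CommRing R] [CommRing S] [Algebra R S] {n : ℕ}
    (u : Matrix (Fin n) (Fin n) (S ⊗[R] S) ≃ₐ[S ⊗[R] S] Matrix (Fin n) (Fin n) (S ⊗[R] S)) :
    Subalgebra R (Matrix (Fin n) (Fin n) S) :=
  AlgHom.equalizer
    ((u.toAlgHom.restrictScalars R).comp
      (Algebra.TensorProduct.includeLeft : S →ₐ[R] S ⊗[R] S).mapMatrix)
    (Algebra.TensorProduct.includeRight : S →ₐ[R] S ⊗[R] S).mapMatrix

end Descent

end InvForm

end

/-! A splitting of `B` is a multiplicative `R`-linear map `φ : B → M_n(S)` that identifies `S ⊗ B`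
with `M_n(S)`. Unital multiplicative linear endomorphisms of a matrix algebra preserve the trace
(`trace_map_of_map_mul`), so `tr φ(b)` depends only on `b` and the target ring. The two pullbacks of
`φ` to `S ⊗ S` thus have equal traces, hence `tr φ(b)` lies in `R` by faithfully flat descent. This
gives a linear form `t` on `B` (`exists_descended_trace`), and `κ_B(a, b) = t(ab)`.

The claims over `R` are checked in `M_n(S)` and brought back by faithful flatness. A linear map with
`f(xy) = f(yx)` is a multiple of the trace (`eq_trace_smul_of_map_mul_comm`); this identifies both
`UIBF` and `AC` with `R`. Each linear form on `M_n(S)` is `tr(x ·)` for a unique `x`, and uniqueness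
makes `x` descend when the form does (`exists_represents`); this gives nonsingularity. The
IBF-principle over `k` then follows formally, since an invariant function induces an additive map on
`UIBF ≅ R`.

In place of Skolem–Noether, trace preservation rests on a determinant computation with matrix units,
valid over any commutative ring (`trace_eq_one_of_matrixUnits`). -/

namespace InvForm

/-! ### Traces on matrix algebras over a commutative ring. -/

section MatrixUnits

variable {m T : Type*} [Fintype m] [DecidableEq m] [CommRing T]

/-- A linear map on matrices which agrees on `x * y` and `y * x` is a multiple of the trace. -/
theorem eq_trace_smul_of_map_mul_comm {N : Type*} [AddCommGroup N] [Module T N]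
    (f : Matrix m m T →ₗ[T] N) (hf : ∀ x y, f (x * y) = f (y * x)) (i₀ : m) (x : Matrix m m T) :
    f x = x.trace • f (Matrix.single i₀ i₀ 1) := by
  -- Diagonal units are the products `E_{i i₀} E_{i₀ i}` in the two orders; off the diagonal,
  -- `E_{ii} E_{ij} = E_{ij}` while `E_{ij} E_{ii} = 0`.
  have hdiag (i : m) : f (Matrix.single i i 1) = f (Matrix.single i₀ i₀ 1) := by
    have h := hf (Matrix.single i i₀ 1) (Matrix.single i₀ i 1)
    simpa using h
  have hoff (i j : m) (hij : i ≠ j) : f (Matrix.single i j 1) = 0 := by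
    have h := hf (Matrix.single i i 1) (Matrix.single i j 1)
    rw [Matrix.single_mul_single_same, Matrix.single_mul_single_of_ne _ _ _ _ hij.symm] at h
    simpa using h
  conv_lhs => rw [Matrix.matrix_eq_sum_single x]
  rw [Matrix.trace, Finset.sum_smul, map_sum]
  refine Finset.sum_congr rfl fun i _ => ?_
  rw [map_sum, Finset.sum_eq_single i]
  · rw [← hdiag i, Matrix.diag_apply, ← map_smul, Matrix.smul_single, smul_eq_mul, mul_one]
  · intro j _ hji
    have : Matrix.single i j (x i j) = x i j • Matrix.single i j (1 : T) := by
      rw [Matrix.smul_single, smul_eq_mul, mul_one]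
    rw [this, map_smul, hoff i j hji.symm, smul_zero]
  · simp

open Polynomial in
/-- If the identity matrix of size `m` is a sum of `m` orthogonal idempotents, which are pairwise
equivalent through a system of matrix units, then these have trace one. -/
theorem trace_eq_one_of_matrixUnits (e : m → m → Matrix m m T)
    (hmul : ∀ i j l, e i j * e j l = e i l) (hzero : ∀ i j l p, j ≠ l → e i j * e l p = 0)
    (hone : ∑ i, e i i = 1) (i₀ : m) : (e i₀ i₀).trace = 1 := by
  -- Over `T[X]`, `D(p) = det(1 + (p - 1) E_{ii})` is multiplicative in `p` and, by `det(1 + AB) =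
  -- det(1 + BA)`, independent of `i`. Taking the product over `i` gives `D(X)^N = X^N`, where `N`
  -- is the size. Using traces alone would give only `N · tr = N`, which is too weak when `N` is a
  -- zero divisor.
  set E : m → m → Matrix m m T[X] := fun i j => (e i j).map C with hE
  have hmap (x y : Matrix m m T) : x.map C * y.map C = (x * y).map (C : T →+* T[X]) :=
    (Matrix.map_mul (f := (C : T →+* T[X]))).symm
  have hEmul (i j l : m) : E i j * E j l = E i l := by simp only [hE, hmap, hmul]
  have hEzero (i j l p : m) (h : j ≠ l) : E i j * E l p = 0 := by
    simp only [hE, hmap, hzero i j l p h]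
    ext; simp
  have hEone : ∑ i, E i i = 1 := by
    have := congrArg (C : T →+* T[X]).mapMatrix hone
    rw [map_sum, map_one] at this
    exact this
  let d : (m → T[X]) →* Matrix m m T[X] :=
    { toFun := fun p => ∑ i, p i • E i i
      map_one' := by simpa using hEone
      map_mul' := fun p q => by
        rw [Finset.sum_mul]
        refine Finset.sum_congr rfl fun i _ => ?_
        rw [Finset.mul_sum, Finset.sum_eq_single i]
        · rw [smul_mul_smul_comm, hEmul, Pi.mul_apply]
        · intro j _ hji
          rw [smul_mul_smul_comm, hEzero _ _ _ _ hji.symm, smul_zero]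
        · simp }
  have hd (i : m) (p : T[X]) : d (Pi.mulSingle i p) = 1 + (p - 1) • E i i := by
    change ∑ j, (Pi.mulSingle i p : m → T[X]) j • E j j = _
    rw [← hEone, ← Finset.add_sum_erase _ _ (Finset.mem_univ i),
      ← Finset.add_sum_erase _ (fun j => E j j) (Finset.mem_univ i), Pi.mulSingle_eq_same]
    have : ∑ j ∈ Finset.univ.erase i, (Pi.mulSingle i p : m → T[X]) j • E j j
        = ∑ j ∈ Finset.univ.erase i, E j j :=
      Finset.sum_congr rfl fun j hj => by
        rw [Pi.mulSingle_eq_of_ne (Finset.ne_of_mem_erase hj), one_smul]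
    rw [this, sub_smul, one_smul]
    abel
  let D : T[X] →* T[X] :=
    { toFun := fun p => (d (Pi.mulSingle i₀ p)).det
      map_one' := by rw [Pi.mulSingle_one, map_one, Matrix.det_one]
      map_mul' := fun p q => by rw [Pi.mulSingle_mul, map_mul, Matrix.det_mul] }
  have hD (p : T[X]) : D p = (1 + (p - 1) • E i₀ i₀).det := congrArg Matrix.det (hd i₀ p)
  have hDi (i : m) (p : T[X]) : (d (Pi.mulSingle i p)).det = D p := by
    rw [hD, hd, ← hEmul i i₀ i, ← smul_mul_assoc, Matrix.det_one_add_mul_comm, mul_smul_comm,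
      hEmul]
  have hpow : D X ^ Fintype.card m = X ^ Fintype.card m := by
    have h1 : d (fun _ => X) = Matrix.scalar m (X : T[X]) := by
      change ∑ i, (X : T[X]) • E i i = _
      rw [← Finset.smul_sum, hEone, Matrix.scalar_apply, Matrix.smul_one_eq_diagonal]
    have h2 := Finset.univ_prod_mulSingle (fun _ : m => (X : T[X]))
    have h3 : (d (fun _ => X)).det = ∏ i : m, (d (Pi.mulSingle i X)).det := by
      rw [← h2]
      exact map_prod (Matrix.detMonoidHom.comp d) _ _
    rw [h1] at h3
    simpa [hDi] using h3.symm
  -- The entries of `E` are constants, so `D(X^N)` is `D(X)` with `X^N` substituted for `X`. As this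
  -- substitution is injective, `D(X)^N = X^N` forces `D(X) = X`.
  have hexp : expand T (Fintype.card m) (D X) = D X ^ Fintype.card m := by
    rw [← map_pow, hD, hD, AlgHom.map_det]
    congr 1
    ext i j
    simp [hE, Matrix.one_apply, apply_ite]
  have hcard : 0 < Fintype.card m := Fintype.card_pos_iff.mpr ⟨i₀⟩
  have hX : D X = X := by
    refine expand_injective hcard ?_
    rw [hexp, hpow, expand_X]
  -- Substitute `1 + X` for `X`; the derivative of `det(1 + X e)` at zero is then the trace.
  have hX1 : (1 + (X : T[X]) • (e i₀ i₀).map C).det = 1 + X := by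
    have := congrArg (Polynomial.compRingHom (1 + X : T[X])) (hD X)
    rw [hX, RingHom.map_det] at this
    rw [coe_compRingHom_apply, X_comp] at this
    rw [this]
    congr 1
    ext i j : 2
    by_cases h : i = j <;> simp [hE, h]
  have htr := Matrix.derivative_det_one_add_X_smul (e i₀ i₀)
  rw [hX1] at htr
  simpa using htr.symm

/-- Unital endomorphisms of a matrix algebra preserve the trace. -/
theorem trace_map_of_map_mul (g : Matrix m m T →ₗ[T] Matrix m m T)
    (hmul : ∀ x y, g (x * y) = g x * g y) (hone : g 1 = 1) (x : Matrix m m T) :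
    (g x).trace = x.trace := by
  rcases isEmpty_or_nonempty m with _ | ⟨⟨i₀⟩⟩
  · simp [Matrix.trace]
  have h := eq_trace_smul_of_map_mul_comm (Matrix.traceLinearMap m T T ∘ₗ g) (fun x y => by
    simp only [LinearMap.comp_apply, hmul, Matrix.traceLinearMap_apply]
    exact Matrix.trace_mul_comm _ _) i₀ x
  have h1 : (g (Matrix.single i₀ i₀ 1)).trace = 1 :=
    trace_eq_one_of_matrixUnits (fun i j => g (Matrix.single i j 1))
      (fun i j l => by rw [← hmul, Matrix.single_mul_single_same, one_mul])
      (fun i j l p hjl => by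
        rw [← hmul, Matrix.single_mul_single_of_ne _ _ _ _ hjl, map_zero])
      (by rw [← map_sum, Matrix.sum_single_one, hone])
      i₀
  simpa [h1] using h

/-- The `T`-linear isomorphism `T ⊗ Matrix m m k ≃ Matrix m m T`. -/
noncomputable def tensorMatrixEquiv (k T m : Type*) [Fintype m] [DecidableEq m]
    [CommRing k] [CommRing T] [Algebra k T] : T ⊗[k] Matrix m m k ≃ₗ[T] Matrix m m T :=
  { (matrixEquivTensor m k T).symm with
    map_smul' := fun t x => by
      change (matrixEquivTensor m k T).symm (t • x) = t • (matrixEquivTensor m k T).symm x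
      induction x with
      | zero => simp
      | add x y hx hy => rw [smul_add, map_add, map_add, hx, hy, smul_add]
      | tmul s x =>
        rw [TensorProduct.smul_tmul', matrixEquivTensor_apply_symm, matrixEquivTensor_apply_symm]
        ext i j
        simp [mul_assoc] }

theorem tensorMatrixEquiv_tmul {k : Type*} [CommRing k] [Algebra k T] (t : T)
    (x : Matrix m m k) : tensorMatrixEquiv k T m (t ⊗ₜ x) = t • x.map (algebraMap k T) := by
  refine (matrixEquivTensor_apply_symm m k T t x).trans ?_
  ext; simp

theorem tensorMatrixEquiv_mul {k : Type*} [CommRing k] [Algebra k T] (x y : T ⊗[k] Matrix m m k) :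
    tensorMatrixEquiv k T m (x * y) = tensorMatrixEquiv k T m x * tensorMatrixEquiv k T m y :=
  map_mul (matrixEquivTensor m k T).symm x y

theorem isBaseChange_mapMatrix (k T m : Type*) [Fintype m] [DecidableEq m]
    [CommRing k] [CommRing T] [Algebra k T] :
    IsBaseChange T (Algebra.ofId k T).mapMatrix.toLinearMap (M := Matrix m m k) :=
  IsBaseChange.of_equiv (tensorMatrixEquiv k T m) fun x => by
    rw [tensorMatrixEquiv_tmul, one_smul]; rfl

theorem traceForm_baseChange {k : Type*} [CommRing k] [Algebra k T] (n : ℕ)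
    (x y : T ⊗[k] Matrix (Fin n) (Fin n) k) :
    (traceForm k n).baseChange T x y =
      (tensorMatrixEquiv k T (Fin n) x * tensorMatrixEquiv k T (Fin n) y).trace := by
  induction x with
  | zero => simp
  | add x x' hx hx' => simp [hx, hx', add_mul]
  | tmul t a =>
    induction y with
    | zero => simp
    | add y y' hy hy' => simp [hy, hy', mul_add]
    | tmul s b =>
      have hab : (a.map (algebraMap k T) * b.map (algebraMap k T)).trace
          = algebraMap k T (a * b).trace := by
        rw [← Matrix.map_mul]
        exact (AddMonoidHom.map_trace (algebraMap k T) (a * b)).symm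
      simp only [LinearMap.BilinForm.baseChange_tmul, tensorMatrixEquiv_tmul, smul_mul_smul_comm,
        Matrix.trace_smul, hab]
      simp [traceForm, Algebra.smul_def, mul_comm]

end MatrixUnits

/-! ### Faithfully flat descent of elements. -/

section Descent

variable {R S : Type*} [CommRing R] [CommRing S] [Algebra R S] [Module.FaithfullyFlat R S]

/-- Faithfully flat descent for elements of a module. -/
theorem exists_eq_one_tmul {M : Type*} [AddCommGroup M] [Module R M] (y : S ⊗[R] M)
    (h : LinearMap.lTensor S (TensorProduct.mk R S M 1) y = 1 ⊗ₜ y) :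
    ∃ x : M, (1 : S) ⊗ₜ[R] x = y := by
  -- The cokernel of `M → S ⊗ M`. Applying `S ⊗ q` to `h` kills the left side and leaves `1 ⊗ q y`,
  -- so `q y = 0`.
  let q := (LinearMap.range (TensorProduct.mk R S M 1)).mkQ
  have hq : q ∘ₗ TensorProduct.mk R S M 1 = 0 := by
    ext x
    exact (Submodule.Quotient.mk_eq_zero _).mpr ⟨x, rfl⟩
  have h1 := congrArg (LinearMap.lTensor S q) h
  rw [← LinearMap.comp_apply, ← LinearMap.lTensor_comp, hq, LinearMap.lTensor_zero,
    LinearMap.zero_apply, LinearMap.lTensor_tmul] at h1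
  have h2 : q y = 0 := (Module.FaithfullyFlat.one_tmul_eq_zero_iff _ _ _).mp h1.symm
  exact (Submodule.Quotient.mk_eq_zero _).mp h2

theorem exists_algebraMap_eq (s : S) (h : s ⊗ₜ[R] (1 : S) = 1 ⊗ₜ s) :
    ∃ r : R, algebraMap R S r = s := by
  obtain ⟨r, hr⟩ := exists_eq_one_tmul (M := R) (s ⊗ₜ[R] (1 : R)) (by
    have := congrArg (LinearMap.lTensor S (TensorProduct.rid R S).symm.toLinearMap) h
    simpa using this)
  refine ⟨r, ?_⟩
  have := congrArg (TensorProduct.rid R S) hr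
  simpa [Algebra.smul_def] using this

end Descent

/-! ### Matrix splittings, their traces and descent of linear forms. -/

/-- An `R`-linear multiplicative map `B → Matrix m m S` which identifies `S ⊗[R] B` with the matrix
algebra. -/
structure IsMatrixSplitting {R S B m : Type*} [CommRing R] [CommRing S] [Algebra R S]
    [Fintype m] [DecidableEq m] [NonUnitalNonAssocRing B] [Module R B]
    (φ : B →ₗ[R] Matrix m m S) : Prop where
  isBaseChange : IsBaseChange S φ
  map_mul : ∀ a b, φ (a * b) = φ a * φ b

namespace IsMatrixSplitting

variable {R S B m : Type*} [CommRing R] [CommRing S] [Algebra R S]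
    [Fintype m] [DecidableEq m] [NonUnitalNonAssocRing B] [Module R B]
    {φ ψ : B →ₗ[R] Matrix m m S}

theorem of_tensor [IsScalarTower R B B] [SMulCommClass R B B]
    (θ : (S ⊗[R] B) ≃ₗ[S] Matrix m m S) (hθ : ∀ x y, θ (x * y) = θ x * θ y) :
    IsMatrixSplitting ((θ.toLinearMap.restrictScalars R) ∘ₗ TensorProduct.mk R S B 1) where
  isBaseChange := IsBaseChange.of_equiv θ fun _ => rfl
  map_mul a b := by
    simp only [LinearMap.comp_apply, TensorProduct.mk_apply, LinearMap.restrictScalars_apply,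
      LinearEquiv.coe_coe, ← hθ, Algebra.TensorProduct.tmul_mul_tmul, mul_one]

theorem isBaseChange_comp_mapMatrix {T : Type*} [CommRing T] [Algebra R T] [Algebra S T]
    [IsScalarTower R S T] (hφ : IsMatrixSplitting φ) :
    IsBaseChange T (((Algebra.ofId S T).mapMatrix (m := m)).toLinearMap.restrictScalars R ∘ₗ φ) :=
  hφ.isBaseChange.comp (isBaseChange_mapMatrix S T m)

theorem map {T : Type*} [CommRing T] [Algebra R T] (hφ : IsMatrixSplitting φ) (i : S →ₐ[R] T) :
    IsMatrixSplitting (i.mapMatrix.toLinearMap ∘ₗ φ) where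
  isBaseChange := by
    let := i.toRingHom.toAlgebra
    have : IsScalarTower R S T := IsScalarTower.of_algebraMap_eq fun r => (i.commutes r).symm
    have h := isBaseChange_comp_mapMatrix (T := T) hφ
    have e : i.mapMatrix.toLinearMap ∘ₗ φ =
      ((Algebra.ofId S T).mapMatrix (m := m)).toLinearMap.restrictScalars R ∘ₗ φ := by
      ext; rfl
    rw [e]
    exact h
  map_mul a b := by
    simp only [LinearMap.comp_apply, hφ.map_mul, AlgHom.toLinearMap_apply, _root_.map_mul]

/-- The image of `φ` spans the matrix algebra over `S`, so bilinear identities on matrices need only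
be checked on `B`. -/
theorem ext₂ {N : Type*} [AddCommGroup N] [Module S N] (hφ : IsMatrixSplitting φ)
    {f g : Matrix m m S →ₗ[S] Matrix m m S →ₗ[S] N}
    (h : ∀ a b, f (φ a) (φ b) = g (φ a) (φ b)) : f = g :=
  hφ.isBaseChange.algHom_ext _ _ fun a => hφ.isBaseChange.algHom_ext _ _ fun b => h a b

/-- A multiplicative `R`-linear map `B → Matrix m m S` extends to an endomorphism of the matrix
algebra. -/
theorem exists_extension (hφ : IsMatrixSplitting φ) (hψ : ∀ a b, ψ (a * b) = ψ a * ψ b) :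
    ∃ g : Matrix m m S →ₗ[S] Matrix m m S, (∀ x y, g (x * y) = g x * g y) ∧
      ∀ b, g (φ b) = ψ b := by
  have hg (b : B) : hφ.isBaseChange.lift ψ (φ b) = ψ b := hφ.isBaseChange.lift_eq ψ b
  refine ⟨hφ.isBaseChange.lift ψ, fun x y => ?_, hg⟩
  have := hφ.ext₂ (f := (LinearMap.mul S _).compr₂ (hφ.isBaseChange.lift ψ))
    (g := (LinearMap.mul S _).compl₁₂ (hφ.isBaseChange.lift ψ) (hφ.isBaseChange.lift ψ))
    fun a b => by simp [← hφ.map_mul, hg, hψ]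
  exact LinearMap.congr_fun₂ this x y

/-- Two splittings over the same ring differ by an automorphism of the matrix algebra. -/
theorem exists_automorphism (hφ : IsMatrixSplitting φ) (hψ : IsMatrixSplitting ψ) :
    ∃ g : Matrix m m S →ₗ[S] Matrix m m S, (∀ x y, g (x * y) = g x * g y) ∧
      (∀ b, g (φ b) = ψ b) ∧ ∀ x, (g x).trace = x.trace := by
  obtain ⟨g, hmul, hg⟩ := hφ.exists_extension hψ.map_mul
  obtain ⟨g', -, hg'⟩ := hψ.exists_extension hφ.map_mul
  have hsurj (x : Matrix m m S) : g (g' x) = x := by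
    have : g ∘ₗ g' = LinearMap.id := hψ.isBaseChange.algHom_ext _ _ fun b => by
      simp [hg', hg]
    exact LinearMap.congr_fun this x
  refine ⟨g, hmul, hg, trace_map_of_map_mul g hmul ?_⟩
  -- Surjectivity makes `g` unital: `g 1` fixes `g (g' 1) = 1` under left multiplication.
  have h := hmul 1 (g' 1)
  rwa [one_mul, hsurj, mul_one, eq_comm] at h

theorem trace_eq (hφ : IsMatrixSplitting φ) (hψ : IsMatrixSplitting ψ) (b : B) :
    (φ b).trace = (ψ b).trace := by
  obtain ⟨g, -, hg, htr⟩ := hφ.exists_automorphism hψ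
  rw [← hg, htr]

theorem injective [Module.FaithfullyFlat R S] (hφ : IsMatrixSplitting φ) :
    Function.Injective φ := by
  intro a b h
  refine Module.FaithfullyFlat.tensorProduct_mk_injective (A := R) (B := S) B ?_
  rw [TensorProduct.mk_apply, TensorProduct.mk_apply, ← hφ.isBaseChange.equiv_symm_apply, ← hφ.isBaseChange.equiv_symm_apply, h]

/-- The trace of a splitting descends to the base ring. -/
theorem exists_descended_trace [Module.FaithfullyFlat R S] (hφ : IsMatrixSplitting φ) :
    ∃ t : B →ₗ[R] R, ∀ b, algebraMap R S (t b) = (φ b).trace := by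
  have hinj := FaithfulSMul.algebraMap_injective R S
  have hex (b : B) : ∃ r : R, algebraMap R S r = (φ b).trace := by
    refine exists_algebraMap_eq _ ?_
    have h := (hφ.map (Algebra.TensorProduct.includeLeft : S →ₐ[R] S ⊗[R] S)).trace_eq
      (hφ.map (Algebra.TensorProduct.includeRight : S →ₐ[R] S ⊗[R] S)) b
    have htr (i : S →ₐ[R] S ⊗[R] S) : (i.mapMatrix (φ b)).trace = i (φ b).trace :=
      (AddMonoidHom.map_trace i (φ b)).symm
    simp only [LinearMap.comp_apply, AlgHom.toLinearMap_apply, htr] at h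
    exact h
  choose t ht using hex
  exact ⟨{ toFun := t
           map_add' := fun a b => hinj (by simp [ht])
           map_smul' := fun r a => hinj (by
             rw [ht, map_smul, Matrix.trace_smul, Algebra.smul_def, ← ht, RingHom.id_apply,
               smul_eq_mul, _root_.map_mul]) }, ht⟩

/-- A descended trace computes the traces of all splittings. -/
theorem algebraMap_trace [Module.FaithfullyFlat R S] (hφ : IsMatrixSplitting φ)
    {t : B →ₗ[R] R} (ht : ∀ b, algebraMap R S (t b) = (φ b).trace)
    {S' : Type*} [CommRing S'] [Algebra R S'] {φ' : B →ₗ[R] Matrix m m S'}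
    (hφ' : IsMatrixSplitting φ') (b : B) : algebraMap R S' (t b) = (φ' b).trace := by
  -- Both splittings are compared over `S' ⊗ S`, into which `S'` embeds because `S` is faithfully
  -- flat over `R`.
  have h := (hφ.map (Algebra.TensorProduct.includeRight : S →ₐ[R] S' ⊗[R] S)).trace_eq
    (hφ'.map (Algebra.TensorProduct.includeLeft : S' →ₐ[R] S' ⊗[R] S)) b
  have h1 : ((Algebra.TensorProduct.includeRight : S →ₐ[R] S' ⊗[R] S).mapMatrix (φ b)).trace
      = (Algebra.TensorProduct.includeRight : S →ₐ[R] S' ⊗[R] S) (φ b).trace :=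
    (AddMonoidHom.map_trace _ (φ b)).symm
  have h2 : ((Algebra.TensorProduct.includeLeft : S' →ₐ[R] S' ⊗[R] S).mapMatrix (φ' b)).trace
      = (Algebra.TensorProduct.includeLeft : S' →ₐ[R] S' ⊗[R] S) (φ' b).trace :=
    (AddMonoidHom.map_trace _ (φ' b)).symm
  refine FaithfulSMul.algebraMap_injective S' (S' ⊗[R] S) ?_
  have h3 : algebraMap S' (S' ⊗[R] S) (φ' b).trace
      = (Algebra.TensorProduct.includeLeft : S' →ₐ[R] S' ⊗[R] S) (φ' b).trace := rfl
  simp only [LinearMap.comp_apply, AlgHom.toLinearMap_apply] at h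
  rw [h3, ← h2, ← h, h1, ← ht, AlgHom.commutes, ← IsScalarTower.algebraMap_apply]

/-- An embedding of `B` into the matrix algebra whose image contains the identity computes the same
trace as a splitting. -/
theorem trace_eq_of_injective (hφ : IsMatrixSplitting φ)
    (hψ : ∀ a b, ψ (a * b) = ψ a * ψ b) (hinj : Function.Injective ψ) (hone : ∃ b, ψ b = 1)
    (b : B) : (ψ b).trace = (φ b).trace := by
  obtain ⟨g, hmul, hg⟩ := hφ.exists_extension hψ
  obtain ⟨e, he⟩ := hone
  -- The preimage of the identity is a left unit of `B`, so `φ e = 1` and the extension `g` of `ψ`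
  -- is unital. That suffices for preserving traces; `g` need not be known to be bijective.
  have he' (b : B) : e * b = b := hinj (by rw [hψ, he, one_mul])
  have hφe : φ e = 1 := by
    have : LinearMap.mulLeft S (φ e) = LinearMap.id := hφ.isBaseChange.algHom_ext _ _ fun b => by
      simp [← hφ.map_mul, he']
    simpa using LinearMap.congr_fun this 1
  rw [← hg, trace_map_of_map_mul g hmul (by rw [← hφe, hg, he, hφe])]

/-- Every linear form on `B` is represented by an element through the descended trace form. -/
theorem exists_represents [Module.FaithfullyFlat R S] (hφ : IsMatrixSplitting φ)
    (f : B →ₗ[R] R) : ∃ a : B, ∀ b, (φ a * φ b).trace = algebraMap R S (f b) := by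
  let F : Matrix m m S →ₗ[S] S := hφ.isBaseChange.lift (Algebra.linearMap R S ∘ₗ f)
  have hF (b : B) : F (φ b) = algebraMap R S (f b) := hφ.isBaseChange.lift_eq _ b
  -- The transposed index makes `x` represent `F`, since `tr(x E_{ij}) = x_{ji}`.
  let x : Matrix m m S := Matrix.of fun i j => F (Matrix.single j i 1)
  have hx (y : Matrix m m S) : (x * y).trace = F y := by
    have : Matrix.traceLinearMap m S S ∘ₗ LinearMap.mulLeft S x = F :=
      Matrix.ext_linearMap _ fun i j => by
        ext
        simp [Matrix.trace_mul_single, x]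
    exact LinearMap.congr_fun this y
  let i₁ : S →ₐ[R] S ⊗[R] S := Algebra.TensorProduct.includeLeft
  let i₂ : S →ₐ[R] S ⊗[R] S := Algebra.TensorProduct.includeRight
  have h₁ := hφ.map i₁
  have h₂ := hφ.map i₂
  obtain ⟨g, hmul, hg, htr⟩ := h₁.exists_automorphism h₂
  have hrep (i : S →ₐ[R] S ⊗[R] S) (b : B) :
      (i.mapMatrix x * i.mapMatrix (φ b)).trace = algebraMap R (S ⊗[R] S) (f b) := by
    rw [← _root_.map_mul]
    refine (AddMonoidHom.map_trace i (x * φ b)).symm.trans ?_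
    rw [hx, hF, AlgHom.commutes]
  -- Both sides represent the base change of `f` for the trace form over `S ⊗ S`, which is
  -- nondegenerate. This equality is the descent condition for `x`.
  have hgx : g (i₁.mapMatrix x) = i₂.mapMatrix x := by
    refine Matrix.ext_iff_trace_mul_right.mpr fun y => ?_
    have : Matrix.traceLinearMap m (S ⊗[R] S) (S ⊗[R] S) ∘ₗ
        LinearMap.mulLeft (S ⊗[R] S) (g (i₁.mapMatrix x)) =
        Matrix.traceLinearMap m (S ⊗[R] S) (S ⊗[R] S) ∘ₗ
        LinearMap.mulLeft (S ⊗[R] S) (i₂.mapMatrix x) :=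
      h₂.isBaseChange.algHom_ext _ _ fun b => by
        change (g (i₁.mapMatrix x) * (i₂.mapMatrix.toLinearMap ∘ₗ φ) b).trace
          = (i₂.mapMatrix x * i₂.mapMatrix (φ b)).trace
        rw [← hg, ← hmul, htr, hrep]
        exact hrep i₁ b
    exact LinearMap.congr_fun this y
  let y : S ⊗[R] B := hφ.isBaseChange.equiv.symm x
  obtain ⟨a, ha⟩ := exists_eq_one_tmul y (by
    -- `E` carries the two sides of the descent condition in `S ⊗ S ⊗ B` to `g (i₁ x)` and `i₂ x`.
    let E : S ⊗[R] (S ⊗[R] B) ≃ₗ[R] Matrix m m (S ⊗[R] S) :=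
      (TensorProduct.assoc R S S B).symm ≪≫ₗ h₂.isBaseChange.equiv.restrictScalars R
    have hE (s s' : S) (b : B) : E (s ⊗ₜ (s' ⊗ₜ b)) = (s ⊗ₜ[R] s') • i₂.mapMatrix (φ b) :=
      h₂.isBaseChange.equiv_tmul _ _
    have hmap (i : S →ₐ[R] S ⊗[R] S) (s : S) (z : Matrix m m S) :
        i.mapMatrix (s • z) = i s • i.mapMatrix z := by
      ext; simp
    have hr (z : S ⊗[R] B) : E (1 ⊗ₜ z) = i₂.mapMatrix (hφ.isBaseChange.equiv z) := by
      induction z with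
      | zero => simp
      | add z w hz hw => rw [TensorProduct.tmul_add, map_add, map_add, map_add, hz, hw]
      | tmul s b =>
        rw [hE, hφ.isBaseChange.equiv_tmul, hmap]
        rfl
    have hl (z : S ⊗[R] B) : E (LinearMap.lTensor S (TensorProduct.mk R S B 1) z)
        = g (i₁.mapMatrix (hφ.isBaseChange.equiv z)) := by
      induction z with
      | zero => simp
      | add z w hz hw => rw [map_add, map_add, map_add, map_add, map_add, hz, hw]
      | tmul s b =>
        rw [LinearMap.lTensor_tmul, TensorProduct.mk_apply, hE, hφ.isBaseChange.equiv_tmul, hmap,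
          map_smul]
        exact congrArg _ (hg b).symm
    apply E.injective
    rw [hl, hr, LinearEquiv.apply_symm_apply, hgx])
  refine ⟨a, fun b => ?_⟩
  have : φ a = x := by
    rw [← one_smul S (φ a), ← hφ.isBaseChange.equiv_tmul, ha, LinearEquiv.apply_symm_apply]
  rw [this, hx, hF]

end IsMatrixSplitting

/-! ### The form `t(ab)`, and factoring invariant functions through a universal form. -/

section ProductForm

variable {R B : Type*} [CommRing R] [NonUnitalNonAssocRing B] [Module R B]
    [IsScalarTower R B B] [SMulCommClass R B B]

/-- The bilinear form `(a, b) ↦ t (a b)`. -/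
def productForm (t : B →ₗ[R] R) : LinearMap.BilinForm R B :=
  (LinearMap.mul R B).compr₂ t

@[simp]
theorem productForm_apply (t : B →ₗ[R] R) (a b : B) : productForm t a b = t (a * b) := rfl

/-- Two rings occur because `T ⊗ B` may become a matrix algebra only over an extension `T'` of `T`:
descended forms use `T' = T`, automorphism invariance uses `T' = T ⊗ S`. -/
theorem algebraMap_productForm_baseChange (t : B →ₗ[R] R) {T T' m : Type*} [CommRing T] [CommRing T']
    [Algebra R T] [Algebra R T'] [Algebra T T'] [IsScalarTower R T T'] [Fintype m] [DecidableEq m]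
    (ψ : T ⊗[R] B →ₗ[T] Matrix m m T') (hψ : ∀ x y, ψ (x * y) = ψ x * ψ y)
    (ht : ∀ b, algebraMap R T' (t b) = (ψ (1 ⊗ₜ b)).trace) (x y : T ⊗[R] B) :
    algebraMap T T' ((productForm t).baseChange T x y) = (ψ x * ψ y).trace := by
  induction x with
  | zero => simp
  | add x x' hx hx' => simp [hx, hx', add_mul]
  | tmul s a =>
    induction y with
    | zero => simp
    | add y y' hy hy' => simp [hy, hy', mul_add]
    | tmul s' b =>
      have h : (s * s') ⊗ₜ[R] (a * b) = (s * s') • ((1 : T) ⊗ₜ[R] (a * b)) := by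
        rw [TensorProduct.smul_tmul', smul_eq_mul, mul_one]
      rw [← hψ, Algebra.TensorProduct.tmul_mul_tmul, h, map_smul, Matrix.trace_smul, ← ht]
      simp [Algebra.smul_def, mul_comm, ← IsScalarTower.algebraMap_apply]

/-- If `β` identifies the universal target with `R`, then every invariant `(R,k)`-bilinear function
factors uniquely through `β`. -/
theorem exists_addEquiv_IBF {k : Type*} [CommRing k] [Algebra k R] [Module k B]
    [IsScalarTower k R B] {β : LinearMap.BilinForm R B} (hβ : IsInvariant β)
    (e : UIBF R B ≃ₗ[R] R) (he : ∀ a b : B, e (univ R B a b) = β a b)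
    (V : Type*) [AddCommGroup V] [Module k V] :
    ∃ Φ : (R →ₗ[k] V) ≃+ IBF k R B V,
      (∀ (φ : R →ₗ[k] V) (a b : B), (Φ φ).1.1 a b = φ (β a b)) ∧
      (∀ (r : R) (φ : R →ₗ[k] V), Φ (φ ∘ₗ Algebra.lsmul k k R r) = r • Φ φ) := by
  have hk₁ (c : k) (a b : B) : β (c • a) b = c • β a b := by
    rw [← algebraMap_smul R c a, map_smul, LinearMap.smul_apply, algebraMap_smul]
  have hk₂ (c : k) (a b : B) : β a (c • b) = c • β a b := by
    rw [← algebraMap_smul R c b, map_smul, algebraMap_smul]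
  let Ψ : (R →ₗ[k] V) →+ IBF k R B V :=
    { toFun := fun φ =>
        ⟨⟨LinearMap.mk₂ k (fun a b => φ (β a b))
            (fun a a' b => by simp) (fun c a b => by rw [hk₁, map_smul])
            (fun a b b' => by simp) (fun c a b => by rw [hk₂, map_smul]),
          fun r a b => by simp⟩,
          fun a b c => ⟨congrArg φ (hβ a b c).1, congrArg φ (hβ a b c).2⟩⟩
      map_zero' := by ext; rfl
      map_add' := fun φ ψ => by ext; rfl }
  have hΨ (φ : R →ₗ[k] V) (a b : B) : (Ψ φ).1.1 a b = φ (β a b) := rfl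
  -- Through `e`, the values of `β` generate `R` as an additive group, so additive identities on `R`
  -- need only be checked on these values.
  have hind {p : R → Prop} (h0 : p 0) (hadd : ∀ x y, p x → p y → p (x + y))
      (hp : ∀ a b, p (β a b)) (x : R) : p x := by
    obtain ⟨z, rfl⟩ := e.surjective x
    obtain ⟨w, rfl⟩ := (ibf R B).mkQ_surjective z
    induction w with
    | zero => simpa using h0
    | add v w hv hw => simpa using hadd _ _ hv hw
    | tmul a b => exact he a b ▸ hp a b
  refine ⟨AddEquiv.ofBijective Ψ ⟨?_, ?_⟩, hΨ, ?_⟩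
  · intro φ ψ h
    ext1 x
    refine hind (p := fun x => φ x = ψ x) (by simp) (fun x y hx hy => by simp [hx, hy])
      (fun a b => ?_) x
    rw [← hΨ, ← hΨ, h]
  · rintro ⟨⟨γ, hγ⟩, hinv⟩
    let g : B ⊗[R] B →+ V := TensorProduct.liftAddHom
      (LinearMap.toAddMonoidHom'.comp γ.toAddMonoidHom) (fun r a b => hγ r a b)
    have hg (a b : B) : g (a ⊗ₜ b) = γ a b := rfl
    have hker : (ibf R B).toAddSubgroup ≤ g.ker := by
      intro z hz
      change z ∈ Submodule.span R _ at hz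
      -- `g` is only additive while `ibf` is an `R`-span, so vanishing is proved for all multiples
      -- `r • z` at once; the scalar is absorbed into an argument of the relation.
      have hsmul : ∀ r : R, g (r • z) = 0 := by
        induction hz using Submodule.span_induction with
        | zero => simp
        | add x y _ _ hx hy => intro r; rw [smul_add, map_add, hx, hy, add_zero]
        | smul s x _ hx => intro r; rw [smul_smul]; exact hx _
        | mem x hx =>
          intro r
          obtain ⟨a, b, c, rfl | rfl⟩ := hx
          · rw [smul_sub, TensorProduct.smul_tmul', TensorProduct.smul_tmul', map_sub, hg, hg,
              ← smul_mul_assoc, (hinv (r • a) b c).1, sub_self]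
          · rw [smul_sub, TensorProduct.smul_tmul', ← TensorProduct.tmul_smul, map_sub, hg, hg,
              ← smul_mul_assoc, ← mul_smul_comm, (hinv (r • a) b c).1, (hinv (r • a) b c).2,
              sub_self]
      simpa using hsmul 1
    let g' : UIBF R B →+ V := QuotientAddGroup.lift _ g hker
    have hg' (a b : B) : g' (univ R B a b) = γ a b := rfl
    have hes (a b : B) : e.symm (β a b) = univ R B a b := by rw [← he, e.symm_apply_apply]
    refine ⟨{ toFun := fun x => g' (e.symm x)
              map_add' := fun x y => by simp
              map_smul' := fun c x => ?_ }, ?_⟩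
    · refine hind (p := fun x => g' (e.symm (c • x)) = c • g' (e.symm x)) (by simp)
        (fun x y hx hy => by simp [hx, hy]) (fun a b => ?_) x
      rw [← hk₁, hes, hes, hg', hg', map_smul, LinearMap.smul_apply]
    · ext a b
      change g' (e.symm (β a b)) = γ a b
      rw [hes, hg']
  · intro r φ
    ext a b
    change φ (r • β a b) = φ (β (r • a) b)
    simp

/-- If `β` identifies the universal target with `R`, then `β` is a basis of the invariant forms. -/
theorem exists_basis_IBF {β : LinearMap.BilinForm R B} (hβ : IsInvariant β)
    (e : UIBF R B ≃ₗ[R] R) (he : ∀ a b : B, e (univ R B a b) = β a b) :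
    ∃ b : Module.Basis Unit R (IBF R R B R), (b ()).1.1 = β := by
  obtain ⟨Φ, hΦ, hΦr⟩ := exists_addEquiv_IBF (k := R) hβ e he R
  let E : R ≃ₗ[R] IBF R R B R :=
    { toFun := fun r => Φ (LinearMap.lsmul R R r)
      invFun := fun γ => Φ.symm γ 1
      left_inv := fun r => by simp
      right_inv := fun γ => by
        rw [← Φ.eq_symm_apply]
        ext
        simp
      map_add' := fun r s => by rw [map_add, map_add]
      map_smul' := fun r s => by
        rw [RingHom.id_apply, ← hΦr]
        congr 1
        ext
        simp [mul_comm] }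
  refine ⟨(Module.Basis.singleton Unit R).map E, ?_⟩
  ext a b
  rw [Module.Basis.map_apply, Module.Basis.singleton_apply]
  exact (hΦ _ a b).trans (by simp)

end ProductForm

/-! ### Invariance, nonsingularity and universality of the descended trace form. -/

namespace IsMatrixSplitting

variable {R S B m : Type*} [CommRing R] [CommRing S] [Algebra R S] [Module.FaithfullyFlat R S]
    [Fintype m] [DecidableEq m] [NonUnitalNonAssocRing B] [Module R B]
    {φ : B →ₗ[R] Matrix m m S} {t : B →ₗ[R] R}

theorem descended_trace_mul_comm (hφ : IsMatrixSplitting φ)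
    (ht : ∀ b, algebraMap R S (t b) = (φ b).trace) (a b : B) : t (a * b) = t (b * a) :=
  FaithfulSMul.algebraMap_injective R S (by
    rw [ht, ht, hφ.map_mul, hφ.map_mul, Matrix.trace_mul_comm])

theorem mul_assoc (hφ : IsMatrixSplitting φ) (a b c : B) : a * b * c = a * (b * c) :=
  hφ.injective (by simp only [hφ.map_mul, _root_.mul_assoc])

variable [IsScalarTower R B B] [SMulCommClass R B B]

theorem isInvariant_productForm (hφ : IsMatrixSplitting φ)
    (ht : ∀ b, algebraMap R S (t b) = (φ b).trace) : IsInvariant (productForm t) := by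
  intro a b c
  simp only [productForm_apply]
  rw [hφ.mul_assoc, hφ.descended_trace_mul_comm ht a, hφ.mul_assoc]
  exact ⟨rfl, rfl⟩

omit [Module.FaithfullyFlat R S] in
theorem algebraMap_productForm (hφ : IsMatrixSplitting φ)
    (ht : ∀ b, algebraMap R S (t b) = (φ b).trace) (a b : B) :
    algebraMap R S (productForm t a b) = (φ a * φ b).trace := by
  rw [productForm_apply, ht, hφ.map_mul]

theorem isNonsingular_productForm (hφ : IsMatrixSplitting φ)
    (ht : ∀ b, algebraMap R S (t b) = (φ b).trace) : IsNonsingular (productForm t) := by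
  constructor
  · intro a a' h
    refine hφ.injective (Matrix.ext_iff_trace_mul_right.mpr fun y => ?_)
    have : Matrix.traceLinearMap m S S ∘ₗ LinearMap.mulLeft S (φ a) =
        Matrix.traceLinearMap m S S ∘ₗ LinearMap.mulLeft S (φ a') :=
      hφ.isBaseChange.algHom_ext _ _ fun b => by
        have := congrArg (algebraMap R S) (LinearMap.congr_fun h b)
        simpa [hφ.algebraMap_productForm ht, ht, hφ.map_mul] using this
    exact LinearMap.congr_fun this y
  · intro f
    obtain ⟨a, ha⟩ := hφ.exists_represents f
    refine ⟨a, LinearMap.ext fun b => FaithfulSMul.algebraMap_injective R S ?_⟩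
    rw [hφ.algebraMap_productForm ht, ha]

theorem isAutInvariant_productForm (hφ : IsMatrixSplitting φ)
    (ht : ∀ b, algebraMap R S (t b) = (φ b).trace) : IsAutInvariant.{w} (productForm t) := by
  intro T _ _ f hf x y
  have h' := hφ.map (Algebra.TensorProduct.includeRight : S →ₐ[R] T ⊗[R] S)
  set φ' := (Algebra.TensorProduct.includeRight : S →ₐ[R] T ⊗[R] S).mapMatrix.toLinearMap ∘ₗ φ
  have hT : IsBaseChange T (TensorProduct.mk R T B 1) := TensorProduct.isBaseChange R B T
  -- A splitting of the `T`-algebra `T ⊗ B` over `T ⊗ S`. Composing it with the automorphism `f`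
  -- gives another, and the two have equal traces.
  let ψ : T ⊗[R] B →ₗ[T] Matrix m m (T ⊗[R] S) := hT.lift φ'
  have hψ1 (b : B) : ψ (1 ⊗ₜ b) = φ' b := hT.lift_eq φ' b
  have hψt (s : T) (b : B) : ψ (s ⊗ₜ b) = s • φ' b := by
    rw [← hψ1, ← map_smul, TensorProduct.smul_tmul', smul_eq_mul, mul_one]
  have hψ : IsMatrixSplitting ψ :=
    { isBaseChange := hT.of_comp (by
        have : (ψ : T ⊗[R] B →ₗ[R] Matrix m m (T ⊗[R] S)) ∘ₗ TensorProduct.mk R T B 1 = φ' :=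
          hT.lift_comp φ'
        rw [this]
        exact h'.isBaseChange)
      map_mul := fun x y => by
        induction x with
        | zero => simp
        | add x x' hx hx' => simp [hx, hx', add_mul]
        | tmul s a =>
          induction y with
          | zero => simp
          | add y y' hy hy' => simp [hy, hy', mul_add]
          | tmul s' b =>
            rw [Algebra.TensorProduct.tmul_mul_tmul, hψt, hψt, hψt, h'.map_mul,
              smul_mul_smul_comm] }
  have hψf : IsMatrixSplitting (ψ ∘ₗ f.toLinearMap) :=
    { isBaseChange := hψ.isBaseChange.comp_equiv f ψ
      map_mul := fun x y => by simp [hf, hψ.map_mul] }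
  have htr := algebraMap_productForm_baseChange t ψ hψ.map_mul fun b => by
    rw [hψ1, hφ.algebraMap_trace ht h']
  refine FaithfulSMul.algebraMap_injective T (T ⊗[R] S) ?_
  rw [htr, htr, ← hψ.map_mul, ← hψ.map_mul, ← hf]
  exact hψf.trace_eq hψ (x * y)

theorem exists_uibf_equiv [Nonempty m] (hφ : IsMatrixSplitting φ)
    (ht : ∀ b, algebraMap R S (t b) = (φ b).trace) :
    ∃ e : UIBF R B ≃ₗ[R] R, ∀ a b : B, e (univ R B a b) = productForm t a b := by
  obtain ⟨i₀⟩ := ‹Nonempty m›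
  have hinv := hφ.isInvariant_productForm ht
  let g : UIBF R B →ₗ[R] R := (ibf R B).liftQ (TensorProduct.lift (productForm t)) (by
    refine Submodule.span_le.mpr ?_
    rintro _ ⟨a, b, c, rfl | rfl⟩
    · simp only [SetLike.mem_coe, LinearMap.mem_ker, map_sub, TensorProduct.lift.tmul]
      rw [(hinv a b c).1, sub_self]
    · simp only [SetLike.mem_coe, LinearMap.mem_ker, map_sub, TensorProduct.lift.tmul]
      rw [(hinv a b c).1, (hinv a b c).2, sub_self])
  have hg (a b : B) : g (univ R B a b) = productForm t a b := rfl
  refine ⟨LinearEquiv.ofBijective g ⟨?_, ?_⟩, hg⟩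
  -- The universal function is extended to matrices. There the unit, which `B` is not assumed to
  -- have, gives `β(x, y) = β(xy, 1)`, hence a multiple of `tr(xy)`. So `1 ⊗ z` is a multiple of `g
  -- z`, and `g z = 0` forces `z = 0`.
  · let β₀ : B →ₗ[R] B →ₗ[R] UIBF R B := (TensorProduct.mk R B B).compr₂ (ibf R B).mkQ
    let β : Matrix m m S →ₗ[S] Matrix m m S →ₗ[S] S ⊗[R] UIBF R B :=
      (LinearMap.BilinMap.baseChange S β₀).compl₁₂ hφ.isBaseChange.equiv.symm.toLinearMap
        hφ.isBaseChange.equiv.symm.toLinearMap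
    have hβ (a b : B) : β (φ a) (φ b) = 1 ⊗ₜ univ R B a b := by
      have h : β (φ a) (φ b) = LinearMap.BilinMap.baseChange S β₀
          (hφ.isBaseChange.equiv.symm (φ a)) (hφ.isBaseChange.equiv.symm (φ b)) := rfl
      rw [h, hφ.isBaseChange.equiv_symm_apply, hφ.isBaseChange.equiv_symm_apply,
        LinearMap.BilinMap.baseChange_tmul, mul_one]
      rfl
    have hassoc (x y z : Matrix m m S) : β (x * y) z = β x (y * z) := by
      induction x using hφ.isBaseChange.inductionOn with
      | zero => simp
      | smul s x hx => simp [hx]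
      | add x x' hx hx' => simp [hx, hx', add_mul]
      | tmul a =>
        have := hφ.ext₂ (f := β ∘ₗ LinearMap.mulLeft S (φ a))
          (g := (LinearMap.mul S (Matrix m m S)).compr₂ (β (φ a))) fun b c => by
            simp only [LinearMap.comp_apply, LinearMap.mulLeft_apply, LinearMap.compr₂_apply,
              LinearMap.mul_apply', ← hφ.map_mul, hβ]
            congr 1
            exact (Submodule.Quotient.eq _).mpr (Submodule.subset_span ⟨a, b, c, .inl rfl⟩)
        exact LinearMap.congr_fun₂ this y z
    have hcomm (x y z : Matrix m m S) : β (x * y) z = β y (z * x) := by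
      induction x using hφ.isBaseChange.inductionOn with
      | zero => simp
      | smul s x hx => simp [hx]
      | add x x' hx hx' => simp [hx, hx', add_mul, mul_add]
      | tmul a =>
        have := hφ.ext₂ (f := β ∘ₗ LinearMap.mulLeft S (φ a))
          (g := β.compl₁₂ LinearMap.id (LinearMap.mulRight S (φ a))) fun b c => by
            simp only [LinearMap.comp_apply, LinearMap.mulLeft_apply, LinearMap.compl₁₂_apply,
              LinearMap.mulRight_apply, LinearMap.id_apply, ← hφ.map_mul, hβ]
            congr 1
            exact (Submodule.Quotient.eq _).mpr (Submodule.subset_span ⟨a, b, c, .inr rfl⟩)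
        exact LinearMap.congr_fun₂ this y z
    have hone (x y : Matrix m m S) : β (x * y) 1 = β x y := by rw [hassoc, mul_one]
    have hsymm (x y : Matrix m m S) : β (x * y) 1 = β (y * x) 1 := by
      rw [hcomm, one_mul, hone]
    have hβtr (x y : Matrix m m S) : β x y = (x * y).trace • β (Matrix.single i₀ i₀ 1) 1 := by
      rw [← hone]
      exact eq_trace_smul_of_map_mul_comm (β.flip 1) hsymm i₀ (x * y)
    refine (injective_iff_map_eq_zero g).mpr fun z hz => ?_
    refine (Module.FaithfullyFlat.one_tmul_eq_zero_iff R _ z (A := S)).mp ?_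
    have key (z : UIBF R B) :
        (1 : S) ⊗ₜ[R] z = algebraMap R S (g z) • β (Matrix.single i₀ i₀ 1) 1 := by
      obtain ⟨w, rfl⟩ := (ibf R B).mkQ_surjective z
      induction w with
      | zero => simp
      | add v w hv hw => rw [map_add, TensorProduct.tmul_add, hv, hw, map_add, map_add, add_smul]
      | tmul a b =>
        refine (hβ a b).symm.trans ?_
        rw [hβtr, ← hφ.algebraMap_productForm ht]
        rfl
    rw [key, hz, map_zero, zero_smul]
  -- Modulo the ideal of values the trace form vanishes on `B`, hence on all matrices; its value `1`
  -- at a diagonal unit then puts `1` in `I`.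
  · let I : Ideal R := LinearMap.range g
    have hI (a b : B) : I.mkQ (productForm t a b) = 0 :=
      (Submodule.Quotient.mk_eq_zero _).mpr ⟨univ R B a b, rfl⟩
    let γ : Matrix m m S →ₗ[S] Matrix m m S →ₗ[S] S ⊗[R] (R ⧸ I) :=
      (LinearMap.mul S (Matrix m m S)).compr₂
        ((LinearMap.toSpanSingleton S _ (1 ⊗ₜ I.mkQ 1)) ∘ₗ Matrix.traceLinearMap m S S)
    have hγ : γ = 0 := hφ.ext₂ fun a b => by
      change (φ a * φ b).trace • ((1 : S) ⊗ₜ[R] I.mkQ 1) = 0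
      rw [← hφ.algebraMap_productForm ht, algebraMap_smul, ← TensorProduct.tmul_smul, ← map_smul,
        smul_eq_mul, mul_one, hI, TensorProduct.tmul_zero]
    have h1 : (1 : S) ⊗ₜ[R] I.mkQ 1 = 0 := by
      have := LinearMap.congr_fun₂ hγ (Matrix.single i₀ i₀ 1) (Matrix.single i₀ i₀ 1)
      simpa [γ] using this
    have h2 : I.mkQ 1 = 0 := (Module.FaithfullyFlat.one_tmul_eq_zero_iff R _ _ (A := S)).mp h1
    have h3 : (1 : R) ∈ I := (Submodule.Quotient.mk_eq_zero _).mp h2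
    exact LinearMap.range_eq_top.mp ((Ideal.eq_top_iff_one I).mpr h3)

theorem exists_ac_equiv [Nonempty m] (hφ : IsMatrixSplitting φ)
    (ht : ∀ b, algebraMap R S (t b) = (φ b).trace) :
    ∃ e : AC R B ≃ₗ[R] R, ∀ a b : B, e ((ac R B).mkQ (a * b)) = productForm t a b := by
  obtain ⟨e, he⟩ := hφ.exists_uibf_equiv ht
  obtain ⟨i₀⟩ := ‹Nonempty m›
  let g : AC R B →ₗ[R] R := (ac R B).liftQ t (by
    refine sup_le (Submodule.span_le.mpr ?_) (Submodule.span_le.mpr ?_)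
    · rintro _ ⟨a, b, c, rfl⟩
      rw [hφ.mul_assoc, sub_self]
      exact zero_mem _
    · rintro _ ⟨a, b, rfl⟩
      rw [SetLike.mem_coe, LinearMap.mem_ker, map_sub, hφ.descended_trace_mul_comm ht, sub_self])
  have hg (a : B) : g ((ac R B).mkQ a) = t a := rfl
  refine ⟨LinearEquiv.ofBijective g ⟨?_, ?_⟩, fun a b => hg _⟩
  · let f : Matrix m m S →ₗ[S] S ⊗[R] AC R B :=
      hφ.isBaseChange.lift (TensorProduct.mk R S _ 1 ∘ₗ (ac R B).mkQ)
    have hf (b : B) : f (φ b) = 1 ⊗ₜ (ac R B).mkQ b := hφ.isBaseChange.lift_eq _ b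
    have hsymm (x y : Matrix m m S) : f (x * y) = f (y * x) := by
      have := hφ.ext₂ (f := (LinearMap.mul S (Matrix m m S)).compr₂ f)
        (g := (LinearMap.mul S (Matrix m m S)).flip.compr₂ f) fun a b => by
          simp only [LinearMap.compr₂_apply, LinearMap.mul_apply', LinearMap.flip_apply,
            ← hφ.map_mul, hf]
          congr 1
          exact (Submodule.Quotient.eq _).mpr
            (Submodule.mem_sup_right (Submodule.subset_span ⟨a, b, rfl⟩))
      exact LinearMap.congr_fun₂ this x y
    refine (injective_iff_map_eq_zero g).mpr fun z hz => ?_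
    obtain ⟨b, rfl⟩ := (ac R B).mkQ_surjective z
    refine (Module.FaithfullyFlat.one_tmul_eq_zero_iff R _ _ (A := S)).mp ?_
    rw [← hf, eq_trace_smul_of_map_mul_comm f hsymm i₀, ← ht, ← hg, hz, map_zero, zero_smul]
  -- Surjectivity is inherited from `e`, as every value of the form is `t` of a product.
  · intro r
    obtain ⟨z, rfl⟩ := e.surjective r
    obtain ⟨w, rfl⟩ := (ibf R B).mkQ_surjective z
    induction w with
    | zero => exact ⟨0, by simp⟩
    | add v w hv hw =>
      obtain ⟨x, hx⟩ := hv
      obtain ⟨y, hy⟩ := hw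
      exact ⟨x + y, by rw [map_add, hx, hy, map_add, map_add]⟩
    | tmul a b => exact ⟨(ac R B).mkQ (a * b), (he a b).symm⟩

end IsMatrixSplitting

/-! ### Characterization as descended form, and realizations inside `M_n(S)`. -/

theorem IsSRForm.exists_tensor_equiv {R S B m : Type*} [CommRing R] [CommRing S] [Algebra R S]
    [Fintype m] [DecidableEq m] [NonUnitalNonAssocRing B] [Module R B]
    [IsScalarTower R B B] [SMulCommClass R B B] (hB : IsSRForm R S (Matrix m m R) B) :
    ∃ θ : (S ⊗[R] B) ≃ₗ[S] Matrix m m S, ∀ x y, θ (x * y) = θ x * θ y := by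
  obtain ⟨θ, hθ⟩ := hB
  refine ⟨θ.trans (tensorMatrixEquiv R S m), fun x y => ?_⟩
  rw [LinearEquiv.trans_apply, hθ, tensorMatrixEquiv_mul]
  rfl

section TraceForm

variable {k R S B : Type*} [CommRing k] [CommRing R] [CommRing S] [Algebra k R]
    [Algebra R S] [Algebra k S] [IsScalarTower k R S] [Module.FaithfullyFlat R S]
    [NonUnitalNonAssocRing B] [Module R B] [IsScalarTower R B B] [SMulCommClass R B B] {n : ℕ}
    {φ : B →ₗ[R] Matrix (Fin n) (Fin n) S} {t : B →ₗ[R] R}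

omit [Algebra k S] [IsScalarTower k R S] in
theorem IsMatrixSplitting.isDescendedForm_productForm (hφ : IsMatrixSplitting φ)
    (ht : ∀ b, algebraMap R S (t b) = (φ b).trace) :
    IsDescendedForm.{v} (traceForm k n) (productForm t) := by
  intro S' _ _ _ _ _ θ hθ x y
  have hmul (x y : S' ⊗[R] B) : (θ.trans (tensorMatrixEquiv k S' (Fin n))) (x * y) =
      (θ.trans (tensorMatrixEquiv k S' (Fin n))) x *
        (θ.trans (tensorMatrixEquiv k S' (Fin n))) y := by
    simp only [LinearEquiv.trans_apply, hθ, tensorMatrixEquiv_mul]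
  have h' := IsMatrixSplitting.of_tensor _ hmul
  rw [traceForm_baseChange]
  exact algebraMap_productForm_baseChange t (T := S') (T' := S')
    (θ.trans (tensorMatrixEquiv k S' (Fin n))).toLinearMap hmul
    (fun b => hφ.algebraMap_trace ht h' b) x y

end TraceForm

theorem IsDescendedForm.eq {k R B : Type*} {S : Type v} [CommRing k] [CommRing R] [CommRing S]
    [Algebra k R] [Algebra R S] [Algebra k S] [IsScalarTower k R S] [Module.FaithfullyFlat R S]
    [NonUnitalNonAssocRing B] [Module R B] [IsScalarTower R B B] [SMulCommClass R B B] {n : ℕ}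
    (θ : (S ⊗[R] B) ≃ₗ[S] Matrix (Fin n) (Fin n) S) (hθ : ∀ x y, θ (x * y) = θ x * θ y)
    {κ κ' : LinearMap.BilinForm R B} (h : IsDescendedForm.{v} (traceForm k n) κ)
    (h' : IsDescendedForm.{v} (traceForm k n) κ') : κ = κ' := by
  have hmul (x y : S ⊗[R] B) : (θ.trans (tensorMatrixEquiv k S (Fin n)).symm) (x * y) =
      (θ.trans (tensorMatrixEquiv k S (Fin n)).symm) x *
        (θ.trans (tensorMatrixEquiv k S (Fin n)).symm) y := by
    apply (tensorMatrixEquiv k S (Fin n)).injective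
    simp only [tensorMatrixEquiv_mul, LinearEquiv.trans_apply, LinearEquiv.apply_symm_apply, hθ]
  ext a b
  apply FaithfulSMul.algebraMap_injective R S
  have := (h S _ hmul (1 ⊗ₜ a) (1 ⊗ₜ b)).trans (h' S _ hmul (1 ⊗ₜ a) (1 ⊗ₜ b)).symm
  simpa [Algebra.smul_def] using this

/-- A `Subalgebra` contains the identity matrix, so its inclusion meets the unit condition of
`trace_eq_of_injective`. -/
theorem IsMatrixSplitting.algebraMap_productForm_of_subalgebra {R S B : Type*} [CommRing R]
    [CommRing S] [Algebra R S]
    [NonUnitalNonAssocRing B] [Module R B] [IsScalarTower R B B] [SMulCommClass R B B] {n : ℕ}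
    {φ : B →ₗ[R] Matrix (Fin n) (Fin n) S} {t : B →ₗ[R] R} (hφ : IsMatrixSplitting φ)
    (ht : ∀ b, algebraMap R S (t b) = (φ b).trace)
    (L : Subalgebra R (Matrix (Fin n) (Fin n) S)) (ι : B ≃ₗ[R] L)
    (hι : ∀ x y, ι (x * y) = ι x * ι y) (a b : B) :
    algebraMap R S (productForm t a b) =
      traceForm S n (ι a : Matrix (Fin n) (Fin n) S) (ι b) := by
  have hmul (a b : B) : (L.val.toLinearMap ∘ₗ ι.toLinearMap) (a * b) =
      (L.val.toLinearMap ∘ₗ ι.toLinearMap) a * (L.val.toLinearMap ∘ₗ ι.toLinearMap) b := by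
    simp [hι]
  have h := hφ.trace_eq_of_injective hmul
    (Subtype.val_injective.comp ι.injective) ⟨ι.symm 1, by simp⟩ (a * b)
  rw [hmul, ← ht] at h
  exact h.symm

end InvForm

theorem mainTheorem6
    (k : Type u₁) (R : Type u₂) (S : Type v) (B : Type u₃) [CommRing k] [CommRing R] [CommRing S]
    [Algebra k R] [Module.Flat k R]
    [Algebra R S] [Algebra k S] [IsScalarTower k R S] [Module.FaithfullyFlat R S]
    [NonUnitalNonAssocRing B] [Module R B] [IsScalarTower R B B] [SMulCommClass R B B]
    [Module k B] [IsScalarTower k R B]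
    (n : ℕ) (hn : 1 ≤ n)
    (hB : InvForm.IsSRForm R S (Matrix (Fin n) (Fin n) R) B) :
    ∃ κB : LinearMap.BilinForm R B,
      -- `κB` is the unique form descended from the trace form of `M_n(k)`
      InvForm.IsDescendedForm.{v} (InvForm.traceForm k n) κB ∧
      (∀ κ' : LinearMap.BilinForm R B,
        InvForm.IsDescendedForm.{v} (InvForm.traceForm k n) κ' → κ' = κB) ∧
      -- (a)
      InvForm.IsNonsingular κB ∧
      InvForm.IsInvariant κB ∧
      InvForm.IsAutInvariant.{w} κB ∧
      (∃ b : Module.Basis Unit R (InvForm.IBF R R B R), (b ()).1.1 = κB) ∧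
      -- (b)
      (∃ e : InvForm.UIBF R B ≃ₗ[R] InvForm.AC R B,
        ∀ a b : B, e (InvForm.univ R B a b) = (InvForm.ac R B).mkQ (a * b)) ∧
      (∃ e : InvForm.AC R B ≃ₗ[R] R, ∀ a b : B, e ((InvForm.ac R B).mkQ (a * b)) = κB a b) ∧
      (∃ e : InvForm.UIBF R B ≃ₗ[R] R, ∀ a b : B, e (InvForm.univ R B a b) = κB a b) ∧
      InvForm.IBFPrinciple.{w'} k κB ∧
      -- (c)
      (∀ (L : Subalgebra R (Matrix (Fin n) (Fin n) S)) (φ : B ≃ₗ[R] L),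
        (∀ x y, φ (x * y) = φ x * φ y) →
          ∀ a b : B, algebraMap R S (κB a b) =
            InvForm.traceForm S n (φ a : Matrix (Fin n) (Fin n) S) (φ b)) ∧
      (∀ (u : Matrix (Fin n) (Fin n) (S ⊗[R] S) ≃ₐ[S ⊗[R] S] Matrix (Fin n) (Fin n) (S ⊗[R] S))
        (φ : B ≃ₗ[R] InvForm.descentSubalgebra u),
        (∀ x y, φ (x * y) = φ x * φ y) →
          ∀ a b : B, algebraMap R S (κB a b) =
            InvForm.traceForm S n (φ a : Matrix (Fin n) (Fin n) S) (φ b)) := by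
  obtain ⟨θ, hθ⟩ := hB.exists_tensor_equiv
  have hφ := InvForm.IsMatrixSplitting.of_tensor θ hθ
  obtain ⟨t, ht⟩ := hφ.exists_descended_trace
  have : Nonempty (Fin n) := ⟨⟨0, hn⟩⟩
  have hdesc : InvForm.IsDescendedForm.{v} (InvForm.traceForm k n) (InvForm.productForm t) :=
    hφ.isDescendedForm_productForm ht
  have hinv := hφ.isInvariant_productForm ht
  obtain ⟨e, he⟩ := hφ.exists_uibf_equiv ht
  obtain ⟨e', he'⟩ := hφ.exists_ac_equiv ht
  refine ⟨InvForm.productForm t, hdesc, fun κ' h' => h'.eq θ hθ hdesc,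
    hφ.isNonsingular_productForm ht, hinv, hφ.isAutInvariant_productForm ht,
    InvForm.exists_basis_IBF hinv e he, ⟨e.trans e'.symm, fun a b => ?_⟩, ⟨e', he'⟩, ⟨e, he⟩,
    ⟨hinv, ⟨e, he⟩, fun V _ _ => InvForm.exists_addEquiv_IBF hinv e he V⟩,
    hφ.algebraMap_productForm_of_subalgebra ht,
    fun u => hφ.algebraMap_productForm_of_subalgebra ht (InvForm.descentSubalgebra u)⟩
  -- The isomorphism from `UIBF` to `AC` passes through `R`, where both classes have the value
  -- `κ_B(a, b)`.
  rw [LinearEquiv.trans_apply, he, ← he', LinearEquiv.symm_apply_apply]
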